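/- Let $A\in\mathbb R^{m\times n}$ with columns $A_1,\dots,A_n$, and let $h:\mathbb R^m\to[0,\infty)$ be continuous and convex. For $(b,\lambda)\in\mathbb R^m\times\mathbb R_{++}$, where $\mathbb R_{++}=(0,\infty)$, let $$S(b,\lambda)=\operatorname*{argmin}_{x\in\mathbb R^n}\{h(Ax-b)+\lambda\|x\|_1\},\qquad H(b,\lambda)=\{Ax : x\in S(b,\lambda)\}.$$ A set-valued mapping $F$ is called Lipschitz continuous relative to a set $D$ if there is $\kappa\in(0,\infty)$ with $d_H(F(u),F(u'))\le\kappa\|u-u'\|$ for all $u,u'\in D$, where $d_H$ is the Hausdorff distance (with values in $[0,\infty]$) and $\|\cdot\|$ is the Euclidean norm; it is called locally Lipschitz continuous at $\bar u$ if it is Lipschitz continuous relative to $B(\bar u,\delta)$ for some $\delta>0$. (i) Let $U\subset\mathbb R^m\times\mathbb R_{++}$ be open and convex. Suppose that $H$ is single-valued (that is, $H(b,\lambda)$ is a singleton for every $(b,\lambda)\in U$) and Lipschitz continuous on $U$, and that $h$ is continuously differentiable at (that is, $C^1$ in a neighborhood of) $Ax-b$ for all $(b,\lambda)\in U$ and all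 $x$ with $Ax\in H(b,\lambda)$. Then $S$ is Lipschitz continuous relative to $U$. (ii) Let $(\bar b,\bar\lambda)\in\mathbb R^m\times\mathbb R_{++}$. Suppose that there is $\bar x\in S(\bar b,\bar\lambda)$ such that $h$ is twice continuously differentiable around $A\bar x-\bar b$ and $$\ker\big(\nabla^2h(A\bar x-\bar b)\big)\cap\operatorname{rge}(A_{J_h})=\{0\},\qquad J_h=\{i\in\{1,\dots,n\} : |A_i^T\nabla h(A\bar x-\bar b)|=\bar\lambda\},$$ where $A_{J_h}$ is the matrix formed by the columns $A_i$, $i\in J_h$, and $\operatorname{rge}$ denotes its range. Then $S$ is locally Lipschitz continuous at $(\bar b,\bar\lambda)$. -/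

import Mathlib

namespace LassoType

/-- The parameter space `ℝ^m × ℝ` of pairs `(b, λ)`, with the Euclidean norm. -/
abbrev Param (m : ℕ) : Type := WithLp 2 (EuclideanSpace ℝ (Fin m) × ℝ)

/-- The `ℓ₁`-norm on `ℝ^n`. -/
def l1norm {n : ℕ} (x : EuclideanSpace ℝ (Fin n)) : ℝ := ∑ i, |x i|

/-- The objective `h (A x - b) + λ ‖x‖₁`, where `p = (b, λ)`. -/
noncomputable def objective {m n : ℕ} (A : Matrix (Fin m) (Fin n) ℝ)
    (h : EuclideanSpace ℝ (Fin m) → ℝ) (p : Param m) (x : EuclideanSpace ℝ (Fin n)) : ℝ :=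
  h (A.toEuclideanLin x - p.fst) + p.snd * l1norm x

/-- The solution mapping `S (b, λ) = argmin_x (h (A x - b) + λ ‖x‖₁)`. -/
def solutionMap {m n : ℕ} (A : Matrix (Fin m) (Fin n) ℝ)
    (h : EuclideanSpace ℝ (Fin m) → ℝ) (p : Param m) : Set (EuclideanSpace ℝ (Fin n)) :=
  {x | ∀ x', objective A h p x ≤ objective A h p x'}

/-- The mapping `H = A ∘ S`, that is `H (b, λ) = {A x : x ∈ S (b, λ)}`. -/
def imageMap {m n : ℕ} (A : Matrix (Fin m) (Fin n) ℝ)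
    (h : EuclideanSpace ℝ (Fin m) → ℝ) (p : Param m) : Set (EuclideanSpace ℝ (Fin m)) :=
  A.toEuclideanLin '' solutionMap A h p

/-- A set-valued mapping is single-valued on `D`. -/
def SingleValuedOn {X Y : Type*} (F : X → Set Y) (D : Set X) : Prop :=
  ∀ x ∈ D, ∃ y, F x = {y}

/-- Lipschitz continuity of a set-valued mapping relative to `D`, in the Hausdorff distance.
The distance is taken in `[0, ∞]`, so it is `∞` between an empty and a nonempty set. -/
def HausdorffLipschitzOn {X Y : Type*} [PseudoMetricSpace X] [PseudoEMetricSpace Y]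
    (F : X → Set Y) (D : Set X) : Prop :=
  ∃ κ : ℝ, 0 < κ ∧ ∀ x ∈ D, ∀ x' ∈ D,
    Metric.hausdorffEDist (F x) (F x') ≤ ENNReal.ofReal (κ * dist x x')

/-- Local Lipschitz continuity of a set-valued mapping around a point, in the Hausdorff
distance. -/
def LocallyHausdorffLipschitzAt {X Y : Type*} [PseudoMetricSpace X] [PseudoEMetricSpace Y]
    (F : X → Set Y) (x₀ : X) : Prop :=
  ∃ δ : ℝ, 0 < δ ∧ HausdorffLipschitzOn F (Metric.ball x₀ δ)

/-- The Hessian `∇²h (z)` as a linear operator: the derivative of the gradient. -/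
noncomputable def hessian {m : ℕ} (h : EuclideanSpace ℝ (Fin m) → ℝ)
    (z : EuclideanSpace ℝ (Fin m)) :
    EuclideanSpace ℝ (Fin m) →L[ℝ] EuclideanSpace ℝ (Fin m) :=
  fderiv ℝ (gradient h) z

/-- The index set `J_h (x) = {i : |A_iᵀ ∇h (A x - b)| = λ}`, where `A_i` is the `i`-th column
of `A`. -/
noncomputable def activeSet {m n : ℕ} (A : Matrix (Fin m) (Fin n) ℝ)
    (h : EuclideanSpace ℝ (Fin m) → ℝ) (p : Param m) (x : EuclideanSpace ℝ (Fin n)) :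
    Finset (Fin n) :=
  {i | |A.col i ⬝ᵥ (gradient h (A.toEuclideanLin x - p.fst)).ofLp| = p.snd}

/-- The range of the matrix `A_I` formed by the columns of `A` with index in `I`. -/
noncomputable def columnRange {m n : ℕ} (A : Matrix (Fin m) (Fin n) ℝ) (I : Finset (Fin n)) :
    Submodule ℝ (EuclideanSpace ℝ (Fin m)) :=
  LinearMap.range (A.submatrix id (fun i : I => (i : Fin n))).toEuclideanLin

/-- The weak condition at `(b, λ)`: for some solution `x`, the function `h` is `C²` around
`A x - b` and `ker ∇²h (A x - b) ∩ rge A_{J_h (x)} = {0}`. -/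
def WeakCondition {m n : ℕ} (A : Matrix (Fin m) (Fin n) ℝ)
    (h : EuclideanSpace ℝ (Fin m) → ℝ) (p : Param m) : Prop :=
  ∃ x ∈ solutionMap A h p,
    ContDiffAt ℝ 2 h (A.toEuclideanLin x - p.fst) ∧
    LinearMap.ker (hessian h (A.toEuclideanLin x - p.fst)).toLinearMap ⊓
      columnRange A (activeSet A h p x) = ⊥

end LassoType

/-! ### Points of least `ℓ₁`-norm in the fibres of a linear map -/

namespace LassoType

open Filter Topology

/-! The term `h (A x - b)` is constant on fibres of `A`, and `λ > 0`. Hence a solution has least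
`ℓ₁`-norm in its fibre, and every point of least norm in the fibre of a solution is again a
solution. The solution set is thus recovered from its image under `A` by minimizing a polyhedral
norm on fibres, and `exists_isL1Minimal_near` says that this recovery is Lipschitz whatever `h` is.
This gives (i) at once and reduces (ii) to a Lipschitz bound for images of solutions.

For the recovery, the difference of two minimal points is shrunk coordinatewise, with its image
fixed, until its `ℓ₁`-norm is least. The orthant face carrying the result then meets the kernel only
at the origin, so its norm is controlled by its image. There are finitely many faces, hence one
constant (`exists_conformal_shrink`).

For (ii), the strict inequalities off `J_h` persist nearby, so solutions with residual `A x - b`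
close to the reference one are supported in `J_h`, and differences of their images lie in `rge
A_{J_h}`. The Hessian is positive definite there, which makes the gradient strongly monotone along
that subspace. Adding the variational inequalities of two solutions then bounds the difference of
their images (`exists_local_image_lipschitz`). Convexity of the solution set makes the image at the
reference parameter unique, and compactness keeps residuals of nearby solutions close to the
reference one. -/

/-- A continuous positively homogeneous function that is positive on a closed cone away from the
origin is bounded below there by a multiple of a power of the norm. -/
lemma exists_pos_mul_norm_pow_le {E : Type*} [NormedAddCommGroup E] [NormedSpace ℝ E]
    [FiniteDimensional ℝ E] {K : Set E} (hK : IsClosed K)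
    (hcone : ∀ x ∈ K, ∀ t : ℝ, 0 ≤ t → t • x ∈ K) {f : E → ℝ} (hf : Continuous f) {k : ℕ}
    (hhom : ∀ x, ∀ t : ℝ, 0 ≤ t → f (t • x) = t ^ k * f x)
    (hpos : ∀ x ∈ K, x ≠ 0 → 0 < f x) (hk : k ≠ 0) :
    ∃ c : ℝ, 0 < c ∧ ∀ x ∈ K, c * ‖x‖ ^ k ≤ f x := by
  have := FiniteDimensional.proper ℝ E
  have hf0 : f 0 = 0 := by simpa [hk] using hhom 0 0 le_rfl
  have hcomp : IsCompact (K ∩ Metric.sphere (0 : E) 1) :=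
    (isCompact_sphere (0 : E) 1).inter_left hK
  obtain ⟨c, hc, hcf⟩ : ∃ c : ℝ, 0 < c ∧ ∀ x ∈ K ∩ Metric.sphere (0 : E) 1, c ≤ f x := by
    rcases (K ∩ Metric.sphere (0 : E) 1).eq_empty_or_nonempty with he | hne
    · exact ⟨1, one_pos, by simp [he]⟩
    · obtain ⟨x₀, hx₀, hmin⟩ := hcomp.exists_isMinOn hne hf.continuousOn
      refine ⟨f x₀, hpos x₀ hx₀.1 ?_, fun x hx => hmin hx⟩
      rintro rfl
      simpa using hx₀.2
  refine ⟨c, hc, fun x hx => ?_⟩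
  by_cases h0 : x = 0
  · simp [h0, hk, hf0]
  have hn : 0 < ‖x‖ := norm_pos_iff.2 h0
  have h1 := hcf (‖x‖⁻¹ • x) ⟨hcone x hx _ (by positivity), by
    simp [norm_smul, hn.ne']⟩
  rw [hhom x _ (by positivity), inv_pow, ← div_eq_inv_mul, le_div_iff₀ (by positivity)] at h1
  exact h1

variable {m n : ℕ}

lemma continuous_l1norm : Continuous (l1norm : EuclideanSpace ℝ (Fin n) → ℝ) := by
  unfold l1norm
  fun_prop

lemma l1norm_nonneg (x : EuclideanSpace ℝ (Fin n)) : 0 ≤ l1norm x :=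
  Finset.sum_nonneg fun _ _ => abs_nonneg _

lemma norm_le_l1norm (x : EuclideanSpace ℝ (Fin n)) : ‖x‖ ≤ l1norm x := by
  rw [EuclideanSpace.norm_eq]
  refine Real.sqrt_le_iff.2 ⟨l1norm_nonneg x, ?_⟩
  have := Finset.sum_sq_le_sq_sum_of_nonneg (s := Finset.univ) (f := fun i => |x i|)
    (fun i _ => abs_nonneg _)
  simpa [l1norm] using this

lemma l1norm_add_le (x y : EuclideanSpace ℝ (Fin n)) : l1norm (x + y) ≤ l1norm x + l1norm y := by
  simp only [l1norm, ← Finset.sum_add_distrib]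
  exact Finset.sum_le_sum fun i _ => abs_add_le _ _

lemma l1norm_smul (t : ℝ) (x : EuclideanSpace ℝ (Fin n)) : l1norm (t • x) = |t| * l1norm x := by
  simp [l1norm, Finset.mul_sum, abs_mul]

lemma l1norm_le_mul_norm (x : EuclideanSpace ℝ (Fin n)) : l1norm x ≤ n * ‖x‖ := by
  have : l1norm x ≤ ∑ _i : Fin n, ‖x‖ :=
    Finset.sum_le_sum fun i _ => by simpa using PiLp.norm_apply_le x i
  simpa using this

/-- The closed face of an orthant given by a sign pattern. -/
def signFace (s : Fin n → SignType) : Set (EuclideanSpace ℝ (Fin n)) :=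
  {d | ∀ i, d i = (s i : ℝ) * |d i|}

lemma isClosed_signFace (s : Fin n → SignType) : IsClosed (signFace s) := by
  simp only [signFace, Set.ofPred_forall]
  exact isClosed_iInter fun i => isClosed_eq (by fun_prop) (by fun_prop)

lemma smul_mem_signFace {s : Fin n → SignType} {x : EuclideanSpace ℝ (Fin n)}
    (hx : x ∈ signFace s) {t : ℝ} (ht : 0 ≤ t) : t • x ∈ signFace s := by
  intro i
  have := hx i
  simp only [PiLp.smul_apply, smul_eq_mul, abs_mul, abs_of_nonneg ht]
  rw [mul_left_comm, ← this]

/-- A linear map is uniformly bounded below on all the faces of orthants that meet its kernel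
only at the origin. -/
lemma exists_norm_le_of_signFace (L : EuclideanSpace ℝ (Fin n) →ₗ[ℝ] EuclideanSpace ℝ (Fin m)) :
    ∃ κ : ℝ, 0 < κ ∧ ∀ s : Fin n → SignType, (∀ e ∈ signFace s, L e = 0 → e = 0) →
      ∀ d ∈ signFace s, ‖d‖ ≤ κ * ‖L d‖ := by
  have hs : ∀ s : Fin n → SignType, ∃ κ : ℝ, 0 < κ ∧ ((∀ e ∈ signFace s, L e = 0 → e = 0) →
      ∀ d ∈ signFace s, ‖d‖ ≤ κ * ‖L d‖) := by
    intro s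
    by_cases h : ∀ e ∈ signFace s, L e = 0 → e = 0
    · obtain ⟨c, hc, hcL⟩ := exists_pos_mul_norm_pow_le (isClosed_signFace s)
        (fun x hx t ht => smul_mem_signFace hx ht) (f := fun x => ‖L x‖) (k := 1)
        (L.continuous_of_finiteDimensional.norm)
        (fun x t ht => by simp [norm_smul, abs_of_nonneg ht])
        (fun x hx hx0 => norm_pos_iff.2 fun h0 => hx0 (h x hx h0)) one_ne_zero
      refine ⟨c⁻¹, inv_pos.2 hc, fun _ d hd => ?_⟩
      have := hcL d hd
      rw [pow_one] at this
      rw [← div_eq_inv_mul, le_div_iff₀ hc, mul_comm]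
      exact this
    · exact ⟨1, one_pos, fun h' => absurd h' h⟩
  choose κ hκ hκL using hs
  -- The sum over the finitely many sign patterns dominates each individual constant.
  refine ⟨∑ s, κ s, Finset.sum_pos (fun s _ => hκ s) Finset.univ_nonempty, fun s h d hd => ?_⟩
  refine (hκL s h d hd).trans ?_
  gcongr
  exact Finset.single_le_sum (fun s _ => (hκ s).le) (Finset.mem_univ s)

/-- Every vector can be shrunk coordinatewise, without changing its image under a linear map,
to a vector whose norm is controlled by that image. -/
lemma exists_conformal_shrink (L : EuclideanSpace ℝ (Fin n) →ₗ[ℝ] EuclideanSpace ℝ (Fin m)) :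
    ∃ κ : ℝ, 0 < κ ∧ ∀ d₀ : EuclideanSpace ℝ (Fin n), ∃ d : EuclideanSpace ℝ (Fin n),
      (∀ i, d i ∈ Set.uIcc 0 (d₀ i)) ∧ L d = L d₀ ∧ ‖d‖ ≤ κ * ‖L d₀‖ := by
  obtain ⟨κ, hκ, hκL⟩ := exists_norm_le_of_signFace L
  refine ⟨κ, hκ, fun d₀ => ?_⟩
  let B : Set (EuclideanSpace ℝ (Fin n)) := {d | (∀ i, d i ∈ Set.uIcc 0 (d₀ i)) ∧ L d = L d₀}
  have hBc : IsClosed B := by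
    have hbox : IsClosed {d : EuclideanSpace ℝ (Fin n) | ∀ i, d i ∈ Set.uIcc 0 (d₀ i)} := by
      simp only [Set.ofPred_forall]
      exact isClosed_iInter fun i =>
        isClosed_Icc.preimage (f := fun d : EuclideanSpace ℝ (Fin n) => d i) (by fun_prop)
    exact hbox.inter (isClosed_eq L.continuous_of_finiteDimensional continuous_const)
  have habs : ∀ {a b : ℝ}, a ∈ Set.uIcc 0 b → |a| ≤ |b| := by
    intro a b hab
    simpa using Set.abs_sub_left_of_mem_uIcc hab
  have hBb : IsCompact B := by
    refine Metric.isCompact_of_isClosed_isBounded hBc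
      ((Metric.isBounded_closedBall (x := 0) (r := l1norm d₀)).subset fun d hd => ?_)
    rw [mem_closedBall_zero_iff]
    exact (norm_le_l1norm d).trans (Finset.sum_le_sum fun i _ => habs (hd.1 i))
  -- Take `d` of least `ℓ₁`-norm in the compact set `B`. A nonzero kernel vector `e` in its face
  -- could be subtracted in a small multiple, staying in `B` and strictly lowering the norm.
  obtain ⟨d, hd, hmin⟩ := hBb.exists_isMinOn ⟨d₀, fun i => Set.right_mem_uIcc, rfl⟩
    continuous_l1norm.continuousOn
  refine ⟨d, hd.1, hd.2, hd.2 ▸ hκL (fun i => SignType.sign (d i)) ?_ d ?_⟩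
  · intro e he hLe
    by_contra hne
    obtain ⟨j, hj⟩ : ∃ j, e j ≠ 0 := by
      by_contra! hall
      exact hne (by ext i; simpa using hall i)
    -- For small `t`, subtracting `t • e` flips no sign of `d`; where `d i = 0`, the face forces `e
    -- i = 0`.
    have hev : ∀ᶠ t in 𝓝[>] (0 : ℝ), ∀ i, t * |e i| ≤ |d i| := by
      refine eventually_all.2 fun i => ?_
      by_cases hdi : d i = 0
      · have : e i = 0 := by simpa [hdi] using he i
        simp [this]
      · have : Tendsto (fun t : ℝ => t * |e i|) (𝓝[>] 0) (𝓝 0) := by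
          have : Tendsto (fun t : ℝ => t * |e i|) (𝓝 0) (𝓝 (0 * |e i|)) :=
            (continuous_id.mul continuous_const).tendsto 0
          rw [zero_mul] at this
          exact this.mono_left nhdsWithin_le_nhds
        exact (this.eventually (gt_mem_nhds (abs_pos.2 hdi))).mono fun t ht => ht.le
    obtain ⟨t, hte, ht⟩ := (hev.and self_mem_nhdsWithin).exists
    have ht : 0 < t := ht
    have hcoord : ∀ i, (d - t • e) i ∈ Set.uIcc 0 (d i) ∧ |(d - t • e) i| = |d i| - t * |e i| := by
      intro i
      have h1 := hte i
      have h2 := he i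
      have h3 : 0 ≤ t * |e i| := by positivity
      simp only [PiLp.sub_apply, PiLp.smul_apply, smul_eq_mul]
      rcases lt_trichotomy (d i) 0 with hdi | hdi | hdi
      · simp only [hdi, sign_neg, SignType.coe_neg, SignType.coe_one] at h2
        rw [abs_of_neg hdi] at h1 ⊢
        have h4 : t * e i = - (t * |e i|) := by rw [h2]; simp
        rw [h4, Set.uIcc_of_ge hdi.le,
          abs_of_nonpos (show d i - -(t * |e i|) ≤ 0 by linarith)]
        exact ⟨⟨by linarith, by linarith⟩, by ring⟩
      · have : e i = 0 := by simpa [hdi] using h2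
        simp [hdi, this]
      · simp only [hdi, sign_pos, SignType.coe_one, one_mul] at h2
        rw [abs_of_pos hdi] at h1 ⊢
        rw [← h2] at h1 h3 ⊢
        rw [Set.uIcc_of_le hdi.le, abs_of_nonneg (by linarith)]
        exact ⟨⟨by linarith, by linarith⟩, rfl⟩
    have hmem : d - t • e ∈ B := by
      refine ⟨fun i => ?_, by simp [hLe, hd.2]⟩
      exact Set.uIcc_subset_uIcc_left (hd.1 i) (hcoord i).1
    have hle : l1norm d ≤ l1norm (d - t • e) := hmin hmem
    have hlt : l1norm (d - t • e) < l1norm d := by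
      refine Finset.sum_lt_sum (fun i _ => ?_) ⟨j, Finset.mem_univ j, ?_⟩
      · rw [(hcoord i).2]
        have : 0 ≤ t * |e i| := by positivity
        linarith
      · rw [(hcoord j).2]
        have : 0 < t * |e j| := by positivity
        linarith
    exact absurd hle hlt.not_ge
  · intro i
    exact (sign_mul_abs (d i)).symm

/-- The point `x` has least `ℓ₁`-norm among the points with the same image under `L`. -/
def IsL1Minimal (L : EuclideanSpace ℝ (Fin n) →ₗ[ℝ] EuclideanSpace ℝ (Fin m))
    (x : EuclideanSpace ℝ (Fin n)) : Prop :=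
  ∀ u, L u = L x → l1norm x ≤ l1norm u

/-- Both `a + e` and `b - e` lie between `a` and `b`, and their sum is `a + b`, so the bound is
convexity of the absolute value. -/
lemma abs_add_abs_sub_le_of_mem_uIcc {a b e : ℝ} (he : e ∈ Set.uIcc 0 (b - a)) :
    |a + e| + |b - e| ≤ |a| + |b| := by
  rcases Set.mem_uIcc.1 he with ⟨h1, h2⟩ | ⟨h1, h2⟩
  · rcases abs_cases a with h | h <;> rcases abs_cases b with h' | h' <;>
      rcases abs_cases (a + e) with h'' | h'' <;> rcases abs_cases (b - e) with h3 | h3 <;>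
      linarith
  · rcases abs_cases a with h | h <;> rcases abs_cases b with h' | h' <;>
      rcases abs_cases (a + e) with h'' | h'' <;> rcases abs_cases (b - e) with h3 | h3 <;>
      linarith

/-- The set of points of least `ℓ₁`-norm in the fibres of a linear map depends on the fibre in a
Lipschitz continuous way. -/
lemma exists_isL1Minimal_near (L : EuclideanSpace ℝ (Fin n) →ₗ[ℝ] EuclideanSpace ℝ (Fin m)) :
    ∃ κ : ℝ, 0 < κ ∧ ∀ x x', IsL1Minimal L x → IsL1Minimal L x' →
      ∃ x'', IsL1Minimal L x'' ∧ L x'' = L x' ∧ ‖x'' - x‖ ≤ κ * ‖L x' - L x‖ := by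
  obtain ⟨κ, hκ, hκL⟩ := exists_conformal_shrink L
  refine ⟨κ, hκ, fun x x' hx hx' => ?_⟩
  obtain ⟨d, hd, hLd, hnorm⟩ := hκL (x' - x)
  have hL : L (x + d) = L x' := by simp [hLd]
  have hsum : l1norm (x' - d) + l1norm (x + d) ≤ l1norm x + l1norm x' := by
    simp only [l1norm, ← Finset.sum_add_distrib]
    refine Finset.sum_le_sum fun i _ => ?_
    have := abs_add_abs_sub_le_of_mem_uIcc (a := x i) (b := x' i) (e := d i)
      (by simpa using hd i)
    simp only [PiLp.sub_apply, PiLp.add_apply]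
    linarith
  -- The point `x' - d` lies in the fibre of `x`, so its norm is at least that of `x`; `hsum` then
  -- makes the norm of `x + d` at most that of `x'`.
  have h1 := hx (x' - d) (by simp [hLd])
  refine ⟨x + d, fun u hu => ?_, hL, by simpa using hnorm⟩
  have h2 := hx' u (hu.trans hL)
  linarith

end LassoType

/-! ### From images of solutions to solutions -/

namespace LassoType

open Filter Topology

variable {m n : ℕ}

section SolutionMap

variable {A : Matrix (Fin m) (Fin n) ℝ} {h : EuclideanSpace ℝ (Fin m) → ℝ}

lemma continuous_toEuclideanLin (A : Matrix (Fin m) (Fin n) ℝ) :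
    Continuous A.toEuclideanLin :=
  LinearMap.continuous_of_finiteDimensional _

lemma isL1Minimal_of_mem_solutionMap {p : Param m} (hp : 0 < p.snd)
    {x : EuclideanSpace ℝ (Fin n)} (hx : x ∈ solutionMap A h p) :
    IsL1Minimal A.toEuclideanLin x := by
  intro u hu
  have := hx u
  simp only [objective, hu, add_le_add_iff_left] at this
  exact le_of_mul_le_mul_left this hp

lemma mem_solutionMap_of_isL1Minimal {p : Param m} (hp : 0 < p.snd)
    {x u : EuclideanSpace ℝ (Fin n)} (hx : x ∈ solutionMap A h p)
    (hu : IsL1Minimal A.toEuclideanLin u) (hux : A.toEuclideanLin u = A.toEuclideanLin x) :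
    u ∈ solutionMap A h p := by
  intro x'
  refine le_trans ?_ (hx x')
  simp only [objective, hux, add_le_add_iff_left]
  exact mul_le_mul_of_nonneg_left (hu x hux.symm) hp.le

lemma continuous_objective (hc : Continuous h) :
    Continuous fun q : Param m × EuclideanSpace ℝ (Fin n) => objective A h q.1 q.2 := by
  have h1 := continuous_toEuclideanLin A
  have h2 := continuous_l1norm (n := n)
  unfold objective
  fun_prop

/-- Since `h` is nonnegative, the `ℓ₁` term alone gives coercivity, hence existence and boundedness
of solutions. -/
lemma mul_norm_le_objective (h0 : ∀ z, 0 ≤ h z) {p : Param m} (hp : 0 < p.snd)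
    (x : EuclideanSpace ℝ (Fin n)) : p.snd * ‖x‖ ≤ objective A h p x := by
  have h1 := mul_le_mul_of_nonneg_left (norm_le_l1norm x) hp.le
  have h2 := h0 (A.toEuclideanLin x - p.fst)
  unfold objective
  linarith

lemma solutionMap_nonempty (h0 : ∀ z, 0 ≤ h z) (hc : Continuous h) {p : Param m}
    (hp : 0 < p.snd) : (solutionMap A h p).Nonempty := by
  have hcont : Continuous (objective A h p) := by
    have h1 := continuous_toEuclideanLin A
    have h2 := continuous_l1norm (n := n)
    unfold objective
    fun_prop
  refine hcont.exists_forall_le (tendsto_atTop_mono (mul_norm_le_objective h0 hp) ?_)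
  exact (tendsto_norm_cocompact_atTop).const_mul_atTop hp

lemma norm_le_of_mem_solutionMap (h0 : ∀ z, 0 ≤ h z) {p : Param m} (hp : 0 < p.snd)
    {x : EuclideanSpace ℝ (Fin n)} (hx : x ∈ solutionMap A h p) : ‖x‖ ≤ h (-p.fst) / p.snd := by
  rw [le_div_iff₀ hp, mul_comm]
  refine (mul_norm_le_objective h0 hp x).trans ((hx 0).trans_eq ?_)
  simp [objective, l1norm]

lemma l1norm_add_smul_sub_le (x u : EuclideanSpace ℝ (Fin n)) {t : ℝ} (ht0 : 0 ≤ t)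
    (ht1 : t ≤ 1) : l1norm (x + t • (u - x)) ≤ (1 - t) * l1norm x + t * l1norm u := by
  have e : x + t • (u - x) = (1 - t) • x + t • u := by module
  rw [e]
  refine (l1norm_add_le _ _).trans_eq ?_
  rw [l1norm_smul, l1norm_smul, abs_of_nonneg ht0, abs_of_nonneg (sub_nonneg.2 ht1)]

lemma objective_add_smul_sub_le (hconv : ConvexOn ℝ Set.univ h) {p : Param m} (hp : 0 ≤ p.snd)
    {x u : EuclideanSpace ℝ (Fin n)} {t : ℝ} (ht0 : 0 ≤ t) (ht1 : t ≤ 1) :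
    objective A h p (x + t • (u - x)) ≤ (1 - t) * objective A h p x + t * objective A h p u := by
  have h1 := hconv.2 (Set.mem_univ (A.toEuclideanLin x - p.fst))
    (Set.mem_univ (A.toEuclideanLin u - p.fst)) (sub_nonneg.2 ht1) ht0 (by ring)
  have e1 : (1 - t) • (A.toEuclideanLin x - p.fst) + t • (A.toEuclideanLin u - p.fst) =
      A.toEuclideanLin (x + t • (u - x)) - p.fst := by
    simp only [map_add, map_smul, map_sub]
    module
  have h3 := mul_le_mul_of_nonneg_left (l1norm_add_smul_sub_le x u ht0 ht1) hp
  rw [e1, smul_eq_mul, smul_eq_mul] at h1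
  unfold objective
  linarith

lemma add_smul_sub_mem_solutionMap (hconv : ConvexOn ℝ Set.univ h) {p : Param m}
    (hp : 0 ≤ p.snd) {x u : EuclideanSpace ℝ (Fin n)} (hx : x ∈ solutionMap A h p)
    (hu : u ∈ solutionMap A h p) {t : ℝ} (ht0 : 0 ≤ t) (ht1 : t ≤ 1) :
    x + t • (u - x) ∈ solutionMap A h p := by
  intro x'
  have h1 := objective_add_smul_sub_le (A := A) hconv hp (x := x) (u := u) ht0 ht1
  have h2 := mul_le_mul_of_nonneg_left (hx x') (sub_nonneg.2 ht1)
  have h3 := mul_le_mul_of_nonneg_left (hu x') ht0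
  linarith

/-- The solution mapping is Lipschitz continuous on every set on which it is nonempty-valued and
its image under `A` is Lipschitz continuous. -/
lemma hausdorffLipschitzOn_solutionMap {D : Set (Param m)} (hpos : ∀ p ∈ D, 0 < p.snd)
    (hne : ∀ p ∈ D, (solutionMap A h p).Nonempty) {κ : ℝ} (hκ : 0 < κ)
    (hlip : ∀ p ∈ D, ∀ p' ∈ D, ∀ x ∈ solutionMap A h p, ∀ x' ∈ solutionMap A h p',
      ‖A.toEuclideanLin x' - A.toEuclideanLin x‖ ≤ κ * dist p p') :
    HausdorffLipschitzOn (solutionMap A h) D := by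
  obtain ⟨μ, hμ, hμL⟩ := exists_isL1Minimal_near A.toEuclideanLin
  have key : ∀ p ∈ D, ∀ p' ∈ D, ∀ x ∈ solutionMap A h p, ∃ u ∈ solutionMap A h p',
      edist x u ≤ ENNReal.ofReal (μ * κ * dist p p') := by
    intro p hp p' hp' x hx
    obtain ⟨x', hx'⟩ := hne p' hp'
    obtain ⟨u, hu, hux', hnorm⟩ := hμL x x' (isL1Minimal_of_mem_solutionMap (hpos p hp) hx)
      (isL1Minimal_of_mem_solutionMap (hpos p' hp') hx')
    refine ⟨u, mem_solutionMap_of_isL1Minimal (hpos p' hp') hx' hu hux', ?_⟩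
    rw [edist_comm, edist_dist, dist_eq_norm]
    refine ENNReal.ofReal_le_ofReal (hnorm.trans ?_)
    rw [mul_assoc]
    exact mul_le_mul_of_nonneg_left (hlip p hp p' hp' x hx x' hx') hμ.le
  refine ⟨μ * κ, by positivity, fun p hp p' hp' =>
    Metric.hausdorffEDist_le_of_mem_edist (key p hp p' hp') fun x hx => ?_⟩
  rw [dist_comm p p']
  exact key p' hp' p hp x hx

/-- The Hausdorff distance of two singletons is the distance of their points, so the hypothesis
bounds `A x' - A x` for any two solutions. Single-valuedness also supplies nonemptiness. -/
lemma hausdorffLipschitzOn_solutionMap_of_imageMap {U : Set (Param m)}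
    (hpos : ∀ p ∈ U, 0 < p.snd) (hsv : SingleValuedOn (imageMap A h) U)
    (hlip : HausdorffLipschitzOn (imageMap A h) U) :
    HausdorffLipschitzOn (solutionMap A h) U := by
  obtain ⟨κ, hκ, hκL⟩ := hlip
  refine hausdorffLipschitzOn_solutionMap hpos (fun p hp => ?_) hκ fun p hp p' hp' x hx x' hx' => ?_
  · obtain ⟨y, hy⟩ := hsv p hp
    exact Set.image_nonempty.1 (hy.symm ▸ Set.singleton_nonempty y : (imageMap A h p).Nonempty)
  · obtain ⟨y, hy⟩ := hsv p hp
    obtain ⟨y', hy'⟩ := hsv p' hp'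
    have hxy : A.toEuclideanLin x = y := by
      have : A.toEuclideanLin x ∈ imageMap A h p := Set.mem_image_of_mem _ hx
      simpa [hy] using this
    have hxy' : A.toEuclideanLin x' = y' := by
      have : A.toEuclideanLin x' ∈ imageMap A h p' := Set.mem_image_of_mem _ hx'
      simpa [hy'] using this
    have := hκL p hp p' hp'
    rw [hy, hy', Metric.hausdorffEDist_singleton, edist_dist,
      ENNReal.ofReal_le_ofReal_iff (by positivity), dist_comm, dist_eq_norm] at this
    rwa [hxy, hxy']

/-- The minimal norm over a fibre is a Lipschitz function of the fibre: compare `x` with a nearby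
minimal point in the fibre of `x'`. The factor `n` comes from `l1norm_le_mul_norm`. -/
lemma abs_l1norm_sub_le_of_isL1Minimal
    (L : EuclideanSpace ℝ (Fin n) →ₗ[ℝ] EuclideanSpace ℝ (Fin m)) :
    ∃ κ : ℝ, 0 ≤ κ ∧ ∀ x x', IsL1Minimal L x → IsL1Minimal L x' →
      |l1norm x' - l1norm x| ≤ κ * ‖L x' - L x‖ := by
  obtain ⟨μ, hμ, hμL⟩ := exists_isL1Minimal_near L
  have key : ∀ x x', IsL1Minimal L x → IsL1Minimal L x' →
      l1norm x' - l1norm x ≤ n * μ * ‖L x' - L x‖ := by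
    intro x x' hx hx'
    obtain ⟨u, hu, hux', hnorm⟩ := hμL x x' hx hx'
    have h1 := hx' u hux'
    have h2 := l1norm_add_le x (u - x)
    have h3 := l1norm_le_mul_norm (u - x)
    have h4 := mul_le_mul_of_nonneg_left hnorm (Nat.cast_nonneg n (α := ℝ))
    rw [add_sub_cancel] at h2
    linarith
  refine ⟨n * μ, by positivity, fun x x' hx hx' => abs_sub_le_iff.2 ⟨key x x' hx hx', ?_⟩⟩
  rw [norm_sub_rev]
  exact key x' x hx' hx

end SolutionMap

end LassoType

/-! ### Gradients and Hessians of convex functions -/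

namespace LassoType

open Filter Topology

variable {m n : ℕ} {h : EuclideanSpace ℝ (Fin m) → ℝ}

lemma hasDerivAt_along_line {z d : EuclideanSpace ℝ (Fin m)} (hd : DifferentiableAt ℝ h z) :
    HasDerivAt (fun t : ℝ => h (z + t • d)) (inner ℝ (gradient h z) d) 0 := by
  have h1 : HasDerivAt (fun t : ℝ => z + t • d) d 0 := by
    simpa using ((hasDerivAt_id (0 : ℝ)).smul_const d).const_add z
  have h2 : HasFDerivAt h (fderiv ℝ h z) (z + (0 : ℝ) • d) := by
    simpa using hd.hasFDerivAt
  have h3 := h2.comp_hasDerivAt (0 : ℝ) h1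
  rwa [← toDual_gradient, InnerProductSpace.toDual_apply_apply] at h3

/-- A one-sided difference quotient bound passes to the directional derivative. -/
lemma le_inner_gradient {z d : EuclideanSpace ℝ (Fin m)} (hd : DifferentiableAt ℝ h z) {c : ℝ}
    (hc : ∀ t : ℝ, 0 < t → t ≤ 1 → t * c ≤ h (z + t • d) - h z) :
    c ≤ inner ℝ (gradient h z) d := by
  have h1 := (hasDerivAt_iff_tendsto_slope.1 (hasDerivAt_along_line (d := d) hd)).mono_left
    (nhdsGT_le_nhdsNE (0 : ℝ))
  refine ge_of_tendsto h1 ?_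
  filter_upwards [Ioc_mem_nhdsGT (zero_lt_one' ℝ)] with t ht
  have := hc t ht.1 ht.2
  rw [slope_def_field, sub_zero, le_div_iff₀ ht.1, mul_comm]
  simpa using this

lemma inner_gradient_le_sub (hconv : ConvexOn ℝ Set.univ h) {z z' : EuclideanSpace ℝ (Fin m)}
    (hd : DifferentiableAt ℝ h z) : inner ℝ (gradient h z) (z' - z) ≤ h z' - h z := by
  have h1 := (hasDerivAt_iff_tendsto_slope.1 (hasDerivAt_along_line (d := z' - z) hd)).mono_left
    (nhdsGT_le_nhdsNE (0 : ℝ))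
  refine le_of_tendsto h1 ?_
  filter_upwards [Ioc_mem_nhdsGT (zero_lt_one' ℝ)] with t ht
  have := hconv.2 (Set.mem_univ z) (Set.mem_univ z') (sub_nonneg.2 ht.2) ht.1.le (by ring)
  have e : (1 - t) • z + t • z' = z + t • (z' - z) := by module
  rw [e, smul_eq_mul, smul_eq_mul] at this
  rw [slope_def_field, sub_zero, div_le_iff₀ ht.1]
  simp only [zero_smul, add_zero]
  linarith

lemma inner_gradient_sub_nonneg (hconv : ConvexOn ℝ Set.univ h)
    {z z' : EuclideanSpace ℝ (Fin m)} (hd : DifferentiableAt ℝ h z)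
    (hd' : DifferentiableAt ℝ h z') :
    0 ≤ inner ℝ (gradient h z' - gradient h z) (z' - z) := by
  have h1 := inner_gradient_le_sub hconv (z' := z') hd
  have h2 := inner_gradient_le_sub hconv (z' := z) hd'
  rw [← neg_sub z' z, inner_neg_right] at h2
  rw [inner_sub_left]
  linarith

lemma gradient_eq_toDual_symm_comp :
    gradient h = (InnerProductSpace.toDual ℝ (EuclideanSpace ℝ (Fin m))).symm ∘ fderiv ℝ h := rfl

lemma contDiffAt_gradient {z : EuclideanSpace ℝ (Fin m)} (hz : ContDiffAt ℝ 2 h z) :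
    ContDiffAt ℝ 1 (gradient h) z := by
  rw [gradient_eq_toDual_symm_comp]
  exact (InnerProductSpace.toDual ℝ
    (EuclideanSpace ℝ (Fin m))).symm.toContinuousLinearEquiv.contDiff.contDiffAt.comp z
    (hz.fderiv_right (m := 1) (by norm_num))

lemma inner_hessian {z : EuclideanSpace ℝ (Fin m)} (hz : ContDiffAt ℝ 2 h z)
    (a b : EuclideanSpace ℝ (Fin m)) :
    inner ℝ (hessian h z a) b = fderiv ℝ (fderiv ℝ h) z a b := by
  have h1 : DifferentiableAt ℝ (fderiv ℝ h) z :=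
    (hz.fderiv_right (m := 1) (by norm_num)).differentiableAt (by norm_num)
  have h2 : HasFDerivAt (gradient h) _ z :=
    (InnerProductSpace.toDual ℝ (EuclideanSpace ℝ (Fin m))).symm.toContinuousLinearEquiv
      |>.toContinuousLinearMap.hasFDerivAt.comp z h1.hasFDerivAt
  rw [hessian, h2.fderiv]
  exact InnerProductSpace.toDual_symm_apply

lemma inner_hessian_comm {z : EuclideanSpace ℝ (Fin m)} (hz : ContDiffAt ℝ 2 h z)
    (a b : EuclideanSpace ℝ (Fin m)) :
    inner ℝ (hessian h z a) b = inner ℝ (hessian h z b) a := by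
  rw [inner_hessian hz, inner_hessian hz]
  exact (hz.isSymmSndFDerivAt (by simp)) a b

lemma eventually_differentiableAt {z : EuclideanSpace ℝ (Fin m)} (hz : ContDiffAt ℝ 2 h z) :
    ∀ᶠ y in 𝓝 z, DifferentiableAt ℝ h y :=
  (hz.eventually (by simp)).mono fun _ hy => hy.differentiableAt (by norm_num)

/-- This is the derivative at `0` of `t ↦ ⟨∇h (z + t w), w⟩`, whose difference quotients for small
`t > 0` are nonnegative by monotonicity of the gradient. -/
lemma inner_hessian_nonneg (hconv : ConvexOn ℝ Set.univ h) {z : EuclideanSpace ℝ (Fin m)}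
    (hz : ContDiffAt ℝ 2 h z) (w : EuclideanSpace ℝ (Fin m)) :
    0 ≤ inner ℝ (hessian h z w) w := by
  have h1 : HasDerivAt (fun t : ℝ => z + t • w) w 0 := by
    simpa using ((hasDerivAt_id (0 : ℝ)).smul_const w).const_add z
  have h2 : HasFDerivAt (gradient h) (hessian h z) (z + (0 : ℝ) • w) := by
    rw [zero_smul, add_zero]
    exact ((contDiffAt_gradient hz).differentiableAt (by norm_num)).hasFDerivAt
  have h3 : HasDerivAt (fun t : ℝ => inner ℝ (gradient h (z + t • w)) w)
      (inner ℝ (hessian h z w) w) 0 := by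
    simpa using (h2.comp_hasDerivAt (0 : ℝ) h1).inner ℝ (hasDerivAt_const (0 : ℝ) w)
  have h4 := (hasDerivAt_iff_tendsto_slope.1 h3).mono_left (nhdsGT_le_nhdsNE (0 : ℝ))
  refine ge_of_tendsto h4 ?_
  have h5 : ∀ᶠ t in 𝓝[>] (0 : ℝ), DifferentiableAt ℝ h (z + t • w) := by
    have h6 : Tendsto (fun t : ℝ => z + t • w) (𝓝 0) (𝓝 z) := by
      simpa using h1.continuousAt.tendsto
    exact (h6.mono_left nhdsWithin_le_nhds).eventually (eventually_differentiableAt hz)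
  filter_upwards [h5, self_mem_nhdsWithin] with t ht ht0
  have ht0 : 0 < t := ht0
  have h7 := inner_gradient_sub_nonneg hconv (eventually_differentiableAt hz).self_of_nhds ht
  rw [add_sub_cancel_left, inner_smul_right, inner_sub_left] at h7
  rw [slope_def_field, sub_zero]
  refine div_nonneg ?_ ht0.le
  simpa using nonneg_of_mul_nonneg_right h7 ht0

/-- With `v = ∇²h(z) w`, the Hessian form at `w + t v` is a nonnegative quadratic in `t` with zero
constant term, so its linear coefficient `2‖v‖²` vanishes. -/
lemma hessian_apply_eq_zero (hconv : ConvexOn ℝ Set.univ h) {z : EuclideanSpace ℝ (Fin m)}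
    (hz : ContDiffAt ℝ 2 h z) {w : EuclideanSpace ℝ (Fin m)}
    (hw : inner ℝ (hessian h z w) w = 0) : hessian h z w = 0 := by
  set v := hessian h z w with hv
  have h1 : ∀ t : ℝ, 0 ≤ inner ℝ (hessian h z v) v * (t * t) + 2 * inner ℝ v v * t + 0 := by
    intro t
    have := inner_hessian_nonneg hconv hz (w + t • v)
    simp only [map_add, map_smul, inner_add_left, inner_add_right, inner_smul_left,
      inner_smul_right, ← hv, hw, inner_hessian_comm hz v w] at this
    simp only [RCLike.conj_to_real] at this
    linarith
  have h2 := discrim_le_zero h1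
  rw [discrim, mul_zero, sub_zero] at h2
  have h3 : inner ℝ v v = 0 := by nlinarith [sq_nonneg (2 * inner ℝ v v)]
  exact inner_self_eq_zero.1 h3

/-- If the kernel of the Hessian of a convex function meets a subspace only at the origin, then
the gradient is locally strongly monotone along this subspace. -/
lemma exists_strongly_monotone_gradient (hconv : ConvexOn ℝ Set.univ h)
    {z₀ : EuclideanSpace ℝ (Fin m)} (hz : ContDiffAt ℝ 2 h z₀)
    {W : Submodule ℝ (EuclideanSpace ℝ (Fin m))}
    (hW : LinearMap.ker (hessian h z₀).toLinearMap ⊓ W = ⊥) :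
    ∃ c M : ℝ, 0 < c ∧ 0 ≤ M ∧ ∀ᶠ q : EuclideanSpace ℝ (Fin m) × EuclideanSpace ℝ (Fin m) in
      𝓝 (z₀, z₀), ∀ w ∈ W, c * ‖w‖ ^ 2 - M * ‖w - (q.1 - q.2)‖ * ‖w‖ ≤
        inner ℝ (gradient h q.1 - gradient h q.2) w := by
  obtain ⟨c, hc, hcW⟩ := exists_pos_mul_norm_pow_le (K := (W : Set (EuclideanSpace ℝ (Fin m))))
    (Submodule.closed_of_finiteDimensional W) (fun x hx t _ => W.smul_mem t hx)
    (f := fun w => inner ℝ (hessian h z₀ w) w) (k := 2) (by fun_prop)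
    (fun x t _ => by
      simp only [map_smul, inner_smul_left, inner_smul_right, RCLike.conj_to_real]; ring)
    (fun x hx hx0 => (inner_hessian_nonneg hconv hz x).lt_of_ne' fun h0 => hx0 <| by
      have : x ∈ LinearMap.ker (hessian h z₀).toLinearMap ⊓ W :=
        ⟨hessian_apply_eq_zero hconv hz h0, hx⟩
      rwa [hW, Submodule.mem_bot] at this) two_ne_zero
  -- Strict differentiability leaves an error of at most `c / 2 * (‖w‖ + ‖r‖) * ‖w‖`, where `r` is
  -- the mismatch between `w` and `q.1 - q.2`. The `‖w‖` part uses up half of `c`; the `‖r‖` part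
  -- joins the Hessian term in `M`.
  refine ⟨c / 2, ‖hessian h z₀‖ + c / 2, half_pos hc, by positivity, ?_⟩
  have h1 : HasStrictFDerivAt (gradient h) (hessian h z₀) z₀ :=
    (contDiffAt_gradient hz).hasStrictFDerivAt (by norm_num)
  filter_upwards [h1.isLittleO.def (half_pos hc)] with q hq w hw
  set r := w - (q.1 - q.2) with hr
  set g := gradient h q.1 - gradient h q.2 with hg
  have h2 : ‖q.1 - q.2‖ ≤ ‖w‖ + ‖r‖ := by
    have : q.1 - q.2 = w - r := by rw [hr]; abel
    rw [this]
    exact norm_sub_le w r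
  have h3 : g = (g - hessian h z₀ (q.1 - q.2)) + hessian h z₀ w - hessian h z₀ r := by
    rw [hr]; simp only [map_sub]; abel
  have h4 := hcW w hw
  have h5 : |inner ℝ (g - hessian h z₀ (q.1 - q.2)) w| ≤ c / 2 * (‖w‖ + ‖r‖) * ‖w‖ :=
    (abs_real_inner_le_norm _ _).trans <| by gcongr; exact hq.trans (by gcongr)
  have h6 : inner ℝ (hessian h z₀ r) w ≤ ‖hessian h z₀‖ * ‖r‖ * ‖w‖ :=
    (real_inner_le_norm _ _).trans <| by gcongr; exact ContinuousLinearMap.le_opNorm _ _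
  have h7 : inner ℝ g w = inner ℝ (g - hessian h z₀ (q.1 - q.2)) w +
      inner ℝ (hessian h z₀ w) w - inner ℝ (hessian h z₀ r) w := by
    rw [← inner_add_left, ← inner_sub_left, ← h3]
  have h8 := (abs_le.1 h5).1
  rw [h7]
  nlinarith

end LassoType

/-! ### Optimality conditions and the local Lipschitz bound -/

namespace LassoType

open Filter Topology

variable {m n : ℕ} {A : Matrix (Fin m) (Fin n) ℝ} {h : EuclideanSpace ℝ (Fin m) → ℝ}

/-- The variational inequality satisfied by a solution. -/
lemma mul_l1norm_sub_le_inner_gradient {p : Param m} (hp : 0 ≤ p.snd)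
    {x : EuclideanSpace ℝ (Fin n)} (hx : x ∈ solutionMap A h p)
    (hd : DifferentiableAt ℝ h (A.toEuclideanLin x - p.fst)) (u : EuclideanSpace ℝ (Fin n)) :
    p.snd * (l1norm x - l1norm u) ≤ inner ℝ (gradient h (A.toEuclideanLin x - p.fst))
      (A.toEuclideanLin u - A.toEuclideanLin x) := by
  refine le_inner_gradient hd fun t ht0 ht1 => ?_
  have h1 := hx (x + t • (u - x))
  have h2 := mul_le_mul_of_nonneg_left (l1norm_add_smul_sub_le x u ht0.le ht1) hp
  have e : A.toEuclideanLin (x + t • (u - x)) - p.fst = A.toEuclideanLin x - p.fst +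
      t • (A.toEuclideanLin u - A.toEuclideanLin x) := by
    simp only [map_add, map_smul, map_sub]
    abel
  simp only [objective, e] at h1
  linarith

lemma l1norm_sub_single (x : EuclideanSpace ℝ (Fin n)) (i : Fin n) :
    l1norm (x - x i • EuclideanSpace.single i (1 : ℝ)) = l1norm x - |x i| := by
  have : ∀ j, |(x - x i • EuclideanSpace.single i (1 : ℝ)) j| =
      |x j| - if j = i then |x i| else 0 := by
    intro j
    by_cases hj : j = i
    · subst hj
      simp
    · simp [hj]
  simp only [l1norm, this, Finset.sum_sub_distrib, Finset.sum_ite_eq', Finset.mem_univ, if_true]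

lemma l1norm_single (i : Fin n) (t : ℝ) :
    l1norm (t • EuclideanSpace.single i (1 : ℝ)) = |t| := by
  simp [l1norm, apply_ite abs]

/-- Setting the coordinate `i` to zero in the variational inequality gives `λ |x i| ≤ |x i| |⟨∇h,
A_i⟩|`, impossible for `x i ≠ 0`. -/
lemma apply_eq_zero_of_abs_inner_gradient_lt {p : Param m} (hp : 0 ≤ p.snd)
    {x : EuclideanSpace ℝ (Fin n)} (hx : x ∈ solutionMap A h p)
    (hd : DifferentiableAt ℝ h (A.toEuclideanLin x - p.fst)) {i : Fin n}
    (hi : |inner ℝ (gradient h (A.toEuclideanLin x - p.fst))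
      (A.toEuclideanLin (EuclideanSpace.single i 1))| < p.snd) : x i = 0 := by
  by_contra h0
  have h1 := mul_l1norm_sub_le_inner_gradient hp hx hd (x - x i • EuclideanSpace.single i (1 : ℝ))
  rw [l1norm_sub_single, map_sub, map_smul, sub_sub_cancel, sub_sub_cancel_left, inner_neg_right,
    inner_smul_right] at h1
  have h2 := (le_abs_self _).trans_eq (abs_neg (x i *
    inner ℝ (gradient h (A.toEuclideanLin x - p.fst))
      (A.toEuclideanLin (EuclideanSpace.single i 1))))
  rw [abs_mul] at h2
  have h3 := mul_lt_mul_of_pos_left hi (abs_pos.2 h0)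
  linarith

/-- Test the variational inequality with `x ± e_i`, which raises the `ℓ₁`-norm by at most one. -/
lemma abs_inner_gradient_le {p : Param m} (hp : 0 ≤ p.snd)
    {x : EuclideanSpace ℝ (Fin n)} (hx : x ∈ solutionMap A h p)
    (hd : DifferentiableAt ℝ h (A.toEuclideanLin x - p.fst)) (i : Fin n) :
    |inner ℝ (gradient h (A.toEuclideanLin x - p.fst))
      (A.toEuclideanLin (EuclideanSpace.single i 1))| ≤ p.snd := by
  have key : ∀ t : ℝ, |t| = 1 → -p.snd ≤ t * inner ℝ (gradient h (A.toEuclideanLin x - p.fst))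
      (A.toEuclideanLin (EuclideanSpace.single i 1)) := by
    intro t ht
    have h1 := mul_l1norm_sub_le_inner_gradient hp hx hd (x + t • EuclideanSpace.single i (1 : ℝ))
    have h2 := l1norm_add_le x (t • EuclideanSpace.single i (1 : ℝ))
    rw [map_add, map_smul, add_sub_cancel_left, inner_smul_right] at h1
    rw [l1norm_single, ht] at h2
    refine le_trans ?_ h1
    nlinarith
  have h1 := key 1 (by simp)
  have h2 := key (-1) (by simp)
  exact abs_le.2 ⟨by linarith, by linarith⟩

lemma col_dotProduct (A : Matrix (Fin m) (Fin n) ℝ) (i : Fin n) (v : EuclideanSpace ℝ (Fin m)) :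
    A.col i ⬝ᵥ v.ofLp = inner ℝ v (A.toEuclideanLin (EuclideanSpace.single i 1)) := by
  simp [EuclideanSpace.inner_eq_star_dotProduct, Matrix.toLpLin_apply]

lemma toEuclideanLin_mem_columnRange {x : EuclideanSpace ℝ (Fin n)} {I : Finset (Fin n)}
    (hx : ∀ i ∉ I, x i = 0) : A.toEuclideanLin x ∈ columnRange A I := by
  refine ⟨WithLp.toLp 2 fun i : I => x i, ?_⟩
  ext j
  change ∑ i : I, A j i * x i = ∑ i, A j i * x i
  rw [Finset.sum_coe_sort I (fun i => A j i * x i)]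
  exact Finset.sum_subset (Finset.subset_univ I) fun i _ hi => by simp [hx i hi]

/-- Near a pair `(p₀, A x₀ - b₀)` satisfying the weak condition, the images of solutions depend
on the parameter in a Lipschitz continuous way. -/
lemma exists_local_image_lipschitz (hconv : ConvexOn ℝ Set.univ h) {p₀ : Param m}
    (hp₀ : 0 < p₀.snd) {x₀ : EuclideanSpace ℝ (Fin n)} (hx₀ : x₀ ∈ solutionMap A h p₀)
    (hz : ContDiffAt ℝ 2 h (A.toEuclideanLin x₀ - p₀.fst))
    (hW : LinearMap.ker (hessian h (A.toEuclideanLin x₀ - p₀.fst)).toLinearMap ⊓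
      columnRange A (activeSet A h p₀ x₀) = ⊥) :
    ∃ κ δ : ℝ, 0 < κ ∧ 0 < δ ∧ (∀ p ∈ Metric.ball p₀ δ, 0 < p.snd) ∧
      ∀ p ∈ Metric.ball p₀ δ, ∀ p' ∈ Metric.ball p₀ δ,
      ∀ x ∈ solutionMap A h p, ∀ x' ∈ solutionMap A h p',
      A.toEuclideanLin x - p.fst ∈ Metric.ball (A.toEuclideanLin x₀ - p₀.fst) δ →
      A.toEuclideanLin x' - p'.fst ∈ Metric.ball (A.toEuclideanLin x₀ - p₀.fst) δ →
      ‖A.toEuclideanLin x' - A.toEuclideanLin x‖ ≤ κ * dist p p' := by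
  set z₀ := A.toEuclideanLin x₀ - p₀.fst with hz₀
  set J := activeSet A h p₀ x₀ with hJ
  obtain ⟨c, M, hc, hM, hmono⟩ := exists_strongly_monotone_gradient hconv hz hW
  obtain ⟨C, hC, hl1⟩ := abs_l1norm_sub_le_of_isL1Minimal A.toEuclideanLin
  have hinactive : ∀ i ∉ J, |inner ℝ (gradient h z₀)
      (A.toEuclideanLin (EuclideanSpace.single i 1))| < p₀.snd := by
    intro i hi
    refine lt_of_le_of_ne (abs_inner_gradient_le hp₀.le hx₀
      (eventually_differentiableAt hz).self_of_nhds i) fun heq => hi ?_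
    rw [hJ, activeSet, Finset.mem_filter]
    refine ⟨Finset.mem_univ i, ?_⟩
    rw [col_dotProduct]
    exact heq
  have hsnd : Continuous fun p : Param m => p.snd := WithLp.continuous_snd 2 _ _
  have hev : ∀ᶠ q : Param m × EuclideanSpace ℝ (Fin m) in 𝓝 (p₀, z₀), 0 < q.1.snd ∧
      DifferentiableAt ℝ h q.2 ∧ ∀ i, i ∉ J → |inner ℝ (gradient h q.2)
        (A.toEuclideanLin (EuclideanSpace.single i 1))| < q.1.snd := by
    have h1 : Tendsto (fun q : Param m × EuclideanSpace ℝ (Fin m) => q.1.snd) (𝓝 (p₀, z₀))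
        (𝓝 p₀.snd) := (hsnd.comp continuous_fst).tendsto (p₀, z₀)
    have h2 : Tendsto (fun q : Param m × EuclideanSpace ℝ (Fin m) => q.2) (𝓝 (p₀, z₀))
        (𝓝 z₀) := continuous_snd.tendsto (p₀, z₀)
    have h3 : Tendsto (fun q : Param m × EuclideanSpace ℝ (Fin m) => gradient h q.2)
        (𝓝 (p₀, z₀)) (𝓝 (gradient h z₀)) :=
      (contDiffAt_gradient hz).continuousAt.tendsto.comp h2
    refine (h1.eventually (lt_mem_nhds hp₀)).and ((h2.eventually
      (eventually_differentiableAt hz)).and (eventually_all.2 fun i => ?_))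
    by_cases hi : i ∈ J
    · simp [hi]
    · exact (((h3.inner tendsto_const_nhds).abs).eventually_lt h1 (hinactive i hi)).mono
        fun q hq _ => hq
  obtain ⟨δ₁, hδ₁, h₁⟩ := Metric.eventually_nhds_iff_ball.1 hev
  obtain ⟨δ₂, hδ₂, h₂⟩ := Metric.eventually_nhds_iff_ball.1 hmono
  have hpair : ∀ p ∈ Metric.ball p₀ (min δ₁ δ₂), ∀ z ∈ Metric.ball z₀ (min δ₁ δ₂),
      (p, z) ∈ Metric.ball (p₀, z₀) δ₁ := by
    intro p hp z hz
    rw [← ball_prod_same]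
    exact ⟨Metric.ball_subset_ball (min_le_left _ _) hp,
      Metric.ball_subset_ball (min_le_left _ _) hz⟩
  -- `M` accounts for the change in `b` and `C` for the change in `λ`; the `1` only ensures
  -- positivity.
  refine ⟨(M + C + 1) / c, min δ₁ δ₂, by positivity, lt_min hδ₁ hδ₂, fun p hp =>
    (h₁ (p, z₀) (hpair p hp z₀ (Metric.mem_ball_self (lt_min hδ₁ hδ₂)))).1, ?_⟩
  intro p hp p' hp' x hx x' hx' hzx hzx'
  obtain ⟨hs, hd, hin⟩ := h₁ _ (hpair p hp _ hzx)
  obtain ⟨hs', hd', hin'⟩ := h₁ _ (hpair p' hp' _ hzx')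
  simp only at hs hd hin hs' hd' hin'
  set z := A.toEuclideanLin x - p.fst with hzdef
  set z' := A.toEuclideanLin x' - p'.fst with hzdef'
  set w := A.toEuclideanLin x' - A.toEuclideanLin x with hw
  have hwW : w ∈ columnRange A J := by
    rw [hw, ← map_sub]
    refine toEuclideanLin_mem_columnRange fun i hi => ?_
    rw [PiLp.sub_apply, apply_eq_zero_of_abs_inner_gradient_lt hs.le hx hd (hin i hi),
      apply_eq_zero_of_abs_inner_gradient_lt hs'.le hx' hd' (hin' i hi), sub_zero]
  have hb : ‖w - (z' - z)‖ ≤ dist p p' := by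
    have : w - (z' - z) = p'.fst - p.fst := by
      rw [hw, hzdef, hzdef']
      abel
    rw [this, ← dist_eq_norm, dist_comm p p']
    exact WithLp.dist_fst_le p' p
  have hl : |p.snd - p'.snd| ≤ dist p p' := by
    rw [← Real.dist_eq]
    exact WithLp.dist_snd_le p p'
  -- Each solution is tested against the other. The sum reads `⟨∇h z' - ∇h z, w⟩ ≤ (λ - λ') (‖x'‖₁ -
  -- ‖x‖₁)`, to be compared with strong monotonicity.
  have hv1 := mul_l1norm_sub_le_inner_gradient hs.le hx hd x'
  have hv2 := mul_l1norm_sub_le_inner_gradient hs'.le hx' hd' x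
  rw [← neg_sub (A.toEuclideanLin x'), inner_neg_right] at hv2
  rw [← hzdef, ← hw] at hv1
  rw [← hzdef', ← hw] at hv2
  have hmem : (z', z) ∈ Metric.ball (z₀, z₀) δ₂ := by
    rw [← ball_prod_same]
    exact ⟨Metric.ball_subset_ball (min_le_right _ _) hzx',
      Metric.ball_subset_ball (min_le_right _ _) hzx⟩
  have hm := h₂ (z', z) hmem w hwW
  simp only [inner_sub_left] at hm
  have hdiff : (p.snd - p'.snd) * (l1norm x' - l1norm x) ≤ dist p p' * (C * ‖w‖) := by
    refine (le_abs_self _).trans ?_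
    rw [abs_mul]
    exact mul_le_mul hl (hl1 x x' (isL1Minimal_of_mem_solutionMap hs hx)
      (isL1Minimal_of_mem_solutionMap hs' hx')) (abs_nonneg _) dist_nonneg
  have hb' : M * ‖w - (z' - z)‖ * ‖w‖ ≤ M * dist p p' * ‖w‖ := by gcongr
  have hfin : (c * ‖w‖) * ‖w‖ ≤ ((M + C + 1) * dist p p') * ‖w‖ := by
    have : 0 ≤ dist p p' * ‖w‖ := by positivity
    linarith
  rw [div_mul_eq_mul_div, le_div_iff₀ hc, mul_comm]
  rcases (norm_nonneg w).eq_or_lt with h0 | h0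
  · rw [← h0, mul_zero]
    positivity
  · exact le_of_mul_le_mul_right hfin h0

/-- Outer semicontinuity of the residual mapping at a parameter where it is single-valued. -/
lemma eventually_dist_residual_lt (h0 : ∀ z, 0 ≤ h z) (hc : Continuous h) {p₀ : Param m}
    (hp₀ : 0 < p₀.snd) {y₀ : EuclideanSpace ℝ (Fin m)}
    (huniq : ∀ x ∈ solutionMap A h p₀, A.toEuclideanLin x = y₀) {ε : ℝ} (hε : 0 < ε) :
    ∀ᶠ p in 𝓝 p₀, ∀ x ∈ solutionMap A h p,
      dist (A.toEuclideanLin x - p.fst) (y₀ - p₀.fst) < ε := by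
  by_contra hnot
  obtain ⟨p, hp, hx⟩ := exists_seq_forall_of_frequently (not_eventually.1 hnot)
  push Not at hx
  choose x hxS hxε using hx
  have hfst : Tendsto (fun k => (p k).fst) atTop (𝓝 p₀.fst) :=
    ((WithLp.continuous_fst 2 _ _).tendsto p₀).comp hp
  have hsnd : Tendsto (fun k => (p k).snd) atTop (𝓝 p₀.snd) :=
    ((WithLp.continuous_snd 2 _ _).tendsto p₀).comp hp
  -- The bound on solutions depends continuously on the parameter, so a subsequence converges. Its
  -- limit solves the limit problem, yet its residual stays at distance at least `ε`, against
  -- `huniq`.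
  have hbound : ∀ᶠ k in atTop, x k ∈ Metric.closedBall 0 (h (-p₀.fst) / p₀.snd + 1) := by
    have h1 : Tendsto (fun k => h (-(p k).fst) / (p k).snd) atTop
        (𝓝 (h (-p₀.fst) / p₀.snd)) :=
      ((hc.tendsto _).comp hfst.neg).div hsnd hp₀.ne'
    filter_upwards [h1.eventually (gt_mem_nhds (lt_add_one _)),
      hsnd.eventually (lt_mem_nhds hp₀)] with k hk hk0
    rw [mem_closedBall_zero_iff]
    exact (norm_le_of_mem_solutionMap h0 hk0 (hxS k)).trans hk.le
  obtain ⟨a, -, φ, hφ, hφa⟩ :=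
    tendsto_subseq_of_frequently_bounded Metric.isBounded_closedBall hbound.frequently
  have hpφ : Tendsto (fun k => p (φ k)) atTop (𝓝 p₀) := hp.comp hφ.tendsto_atTop
  have hcont := continuous_objective (A := A) hc
  have ha : a ∈ solutionMap A h p₀ := by
    intro u
    exact le_of_tendsto_of_tendsto' ((hcont.tendsto (p₀, a)).comp (hpφ.prodMk_nhds hφa))
      ((hcont.tendsto (p₀, u)).comp (hpφ.prodMk_nhds tendsto_const_nhds)) fun k => hxS (φ k) u
  have hlim : Tendsto (fun k => dist (A.toEuclideanLin (x (φ k)) - (p (φ k)).fst)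
      (y₀ - p₀.fst)) atTop (𝓝 (dist (A.toEuclideanLin a - p₀.fst) (y₀ - p₀.fst))) :=
    (((continuous_toEuclideanLin A).tendsto a |>.comp hφa).sub
      (hfst.comp hφ.tendsto_atTop)).dist tendsto_const_nhds
  have := ge_of_tendsto' hlim fun k => hxε (φ k)
  rw [huniq a ha, dist_self] at this
  exact this.not_gt hε

lemma locallyHausdorffLipschitzAt_of_weakCondition (h0 : ∀ z, 0 ≤ h z) (hc : Continuous h)
    (hconv : ConvexOn ℝ Set.univ h) {p₀ : Param m} (hp₀ : 0 < p₀.snd)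
    (hweak : WeakCondition A h p₀) : LocallyHausdorffLipschitzAt (solutionMap A h) p₀ := by
  obtain ⟨x₀, hx₀, hz, hW⟩ := hweak
  obtain ⟨κ, δ, hκ, hδ, hpos, hlip⟩ := exists_local_image_lipschitz hconv hp₀ hx₀ hz hW
  -- The Lipschitz bound with equal parameters gives uniqueness of images only near the reference
  -- residual. A point of the segment from `x₀` to `x` close to `x₀` is a solution in that range, so
  -- `A` is constant along the segment.
  have huniq : ∀ x ∈ solutionMap A h p₀, A.toEuclideanLin x = A.toEuclideanLin x₀ := by
    intro x hx
    have hlim : Tendsto (fun t : ℝ => A.toEuclideanLin (x₀ + t • (x - x₀)) - p₀.fst) (𝓝[>] 0)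
        (𝓝 (A.toEuclideanLin x₀ - p₀.fst)) := by
      have hcont : Continuous fun t : ℝ => A.toEuclideanLin (x₀ + t • (x - x₀)) - p₀.fst := by
        have := continuous_toEuclideanLin A
        fun_prop
      have := hcont.tendsto 0
      rw [zero_smul, add_zero] at this
      exact this.mono_left nhdsWithin_le_nhds
    obtain ⟨t, htball, ht0, ht1⟩ := ((hlim.eventually (Metric.ball_mem_nhds _ hδ)).and
      (Ioc_mem_nhdsGT (zero_lt_one' ℝ))).exists
    have := hlip p₀ (Metric.mem_ball_self hδ) p₀ (Metric.mem_ball_self hδ) x₀ hx₀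
      _ (add_smul_sub_mem_solutionMap hconv hp₀.le hx₀ hx ht0.le ht1)
      (Metric.mem_ball_self hδ) htball
    rw [dist_self, mul_zero, map_add, add_sub_cancel_left, map_smul, norm_le_zero_iff,
      smul_eq_zero, map_sub, sub_eq_zero] at this
    exact this.resolve_left ht0.ne'
  obtain ⟨η, hη, hnear⟩ :=
    Metric.eventually_nhds_iff_ball.1 (eventually_dist_residual_lt h0 hc hp₀ huniq hδ)
  have hsubδ := Metric.ball_subset_ball (x := p₀) (min_le_left δ η)
  have hsubη := Metric.ball_subset_ball (x := p₀) (min_le_right δ η)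
  refine ⟨min δ η, lt_min hδ hη, hausdorffLipschitzOn_solutionMap
    (fun p hp => hpos p (hsubδ hp))
    (fun p hp => solutionMap_nonempty h0 hc (hpos p (hsubδ hp))) hκ ?_⟩
  intro p hp p' hp' x hx x' hx'
  exact hlip p (hsubδ hp) p' (hsubδ hp') x hx x' hx' (hnear p (hsubη hp) x hx)
    (hnear p' (hsubη hp') x' hx')

end LassoType

theorem theorem3p13 (m n : ℕ) (A : Matrix (Fin m) (Fin n) ℝ)
    (h : EuclideanSpace ℝ (Fin m) → ℝ)
    (h_nonneg : ∀ z, 0 ≤ h z) (h_cont : Continuous h) (h_convex : ConvexOn ℝ Set.univ h) :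
    (∀ U : Set (LassoType.Param m), IsOpen U → Convex ℝ U → (∀ p ∈ U, 0 < p.snd) →
      LassoType.SingleValuedOn (LassoType.imageMap A h) U →
      LassoType.HausdorffLipschitzOn (LassoType.imageMap A h) U →
      (∀ p ∈ U, ∀ x : EuclideanSpace ℝ (Fin n),
        A.toEuclideanLin x ∈ LassoType.imageMap A h p →
          ContDiffAt ℝ 1 h (A.toEuclideanLin x - p.fst)) →
      LassoType.HausdorffLipschitzOn (LassoType.solutionMap A h) U) ∧
    (∀ p₀ : LassoType.Param m, 0 < p₀.snd → LassoType.WeakCondition A h p₀ →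
      LassoType.LocallyHausdorffLipschitzAt (LassoType.solutionMap A h) p₀) := by
  refine ⟨fun U _ _ hpos hsv hlip _ => ?_, fun p₀ hp₀ hweak => ?_⟩
  · exact LassoType.hausdorffLipschitzOn_solutionMap_of_imageMap hpos hsv hlip
  · exact LassoType.locallyHausdorffLipschitzAt_of_weakCondition h_nonneg h_cont h_convex hp₀ hweak
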